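/- **Conventions.** Work in the nonstandard extensions ${}^*\mathbb N,{}^*\mathbb R$ (ultrapowers along a nonprincipal ultrafilter on $\mathbb N$). A hyperreal is *limited* if it is bounded in absolute value by a standard real, *infinitesimal* if its absolute value is smaller than every standard $r>0$, and *appreciable* if it is limited and not infinitesimal. The *halo* (monad) of $x$ is the set of $y$ with $y-x$ infinitesimal. Let $N\in{}^*\mathbb N$ be unlimited and let $I=\{0,\frac1N,\dots,\frac{N-1}N,1\}$. All functions on $I$ and all subsets of $I$ over which one integrates are internal. Put $\int_A f\,d\lambda=\frac1N\sum_{\tau\in A,\ \tau\ne1}f(\tau)$, $\lambda(A)=\int_A 1\,d\lambda$ and $\int_0^t f\,d\tau=\int_{I\cap[0,t)}f\,d\lambda$. * A (possibly external) set $E\subseteq I$ is *rare* if for every standard $r>0$ it is contained in an internal set of measure at most $r$. An internal $A\subseteq I$ is *quadrable* if the set of points of $I$ that are infinitely close both to a point of $A$ and to a point of $I\setminus A$ is rare. * $f:I\to{}^*\mathbb R$ is *$S$-integrable* if $\int_I|f|\,d\lambda$ is limited and $\int_A|f|\,d\lambda$ is infinitesimal whenever $\lambda(A)$ is. * A *zero-mean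 noise* is an $S$-integrable $\mathfrak n:I\to{}^*\mathbb R$ such that $\int_A\mathfrak n\,d\lambda$ is infinitesimal for every quadrable $A\subseteq I$. * A function $\bar\delta:[0,1]\to\mathbb R$ is the *shadow* of $\delta:I\to{}^*\mathbb R$ if $\delta(t)$ is in the halo of $\bar\delta(x)$ whenever $t\in I$ is in the halo of $x\in[0,1]$. Let $\theta\in\mathbb R$. An *estimator* of $\theta$ is given by a zero-mean noise $\mathfrak n$, a function $\delta:I\to{}^*\mathbb R$ whose shadow $\bar\delta$ (the *divisor*) is real analytic on $[0,1]$ with $\bar\delta(0)=0$, and a function $[\theta]_e:I\to{}^*\mathbb R$, related by $$\delta(t)\bigl([\theta]_e(t)-\theta\bigr)=\sum_{i=1}^{r}c_i\int_0^t\int_0^{\tau_{k_i}}\!\!\cdots\int_0^{\tau_2}\tau_1^{\nu_i}\,\mathfrak n(\tau_1)\,d\tau_1\,d\tau_2\cdots d\tau_{k_i},\tag{$*$}$$ a finite sum of $k_i$-fold iterated integrals with limited $c_i\in{}^*\mathbb R$ and integers $\nu_i\ge0$, $k_i\ge1$; for $k_i=1$ the integral is $\int_0^t\tau_1^{\nu_i}\mathfrak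 n(\tau_1)\,d\tau_1$. The interval $[0,t]$, $t\in I$, is the *estimation window*, of length $t$. **Proposition.** 1. Let $t\in I$ be a point at which $(*)$ holds and which is not in the halo of any zero of $\bar\delta$ in $[0,1]$. Then $[\theta]_e(t)$ is in the halo of $\theta$, and $t$ is appreciable. 2. If $t$ is infinitesimal, $[\theta]_e(t)$ need not be in the halo of $\theta$. More precisely, for every unlimited $N$, every $\theta\in\mathbb R$ and every infinitesimal $t\in I$ with $t>0$, there is an estimator as above, satisfying $(*)$ at every point of $I$, whose divisor vanishes only at $0$ and for which $\delta(s)\neq0$ for all $s\in I$ with $s>0$, such that $[\theta]_e(t)$ is not in the halo of $\theta$. -/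

import Mathlib

noncomputable section

namespace NonstandardNoise

open Filter

/-- The nonstandard extension `*α`, as an ultrapower along the nonprincipal ultrafilter on `ℕ` that
Mathlib uses for the hyperreals; `ℝ*` is by definition `NSExt ℝ`. The elements of `NSExt (ℝ → ℝ)` and
`NSExt (Set ℝ)` are the internal functions `ℝ* → ℝ*` and the internal subsets of `ℝ*`. -/
abbrev NSExt (α : Type) : Type := Germ (hyperfilter ℕ : Filter ℕ) α

/-- The inclusion `*ℕ → *ℝ`. -/
def hypernatToHyperreal (k : NSExt ℕ) : Hyperreal := Germ.map (fun m : ℕ => (m : ℝ)) k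

/-- The value at `t` of an internal function. -/
def eval (f : NSExt (ℝ → ℝ)) (t : Hyperreal) : Hyperreal :=
  Germ.map₂ (fun (g : ℝ → ℝ) (x : ℝ) => g x) f t

/-- Membership in an internal set. -/
def InternalMem (t : Hyperreal) (A : NSExt (Set ℝ)) : Prop :=
  Germ.LiftRel (fun (x : ℝ) (B : Set ℝ) => x ∈ B) t A

/-! ### Orders of magnitude -/

def Limited (x : Hyperreal) : Prop := ∃ r : ℝ, |x| ≤ (r : Hyperreal)

def Infinitesimal (x : Hyperreal) : Prop := ∀ r : ℝ, 0 < r → |x| < (r : Hyperreal)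

def Appreciable (x : Hyperreal) : Prop := Limited x ∧ ¬ Infinitesimal x

/-- The halo (monad) of `x`. -/
def halo (x : Hyperreal) : Set Hyperreal := {y | Infinitesimal (y - x)}

/-- A hypernatural number is unlimited if it exceeds every standard natural number. -/
def Unlimited (N : NSExt ℕ) : Prop := ∀ m : ℕ, (Germ.const m : NSExt ℕ) < N

/-! ### The hyperfinite time grid and its Lebesgue measure -/

/-- The hyperfinite grid `{0, 1/N, …, (N-1)/N, 1}`. -/
def grid (N : NSExt ℕ) : Set Hyperreal :=
  {t | ∃ k : NSExt ℕ, k ≤ N ∧ t = hypernatToHyperreal k / hypernatToHyperreal N}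

/-- For a standard `M`: the sum of `g x / M` over the points `x` of `{0, 1/M, …, (M-1)/M}` that lie
in `A`. -/
def gridIntegral (M : ℕ) (A : Set ℝ) (g : ℝ → ℝ) : ℝ :=
  ∑ k ∈ Finset.range M, A.indicator g ((k : ℝ) / (M : ℝ)) / (M : ℝ)

/-- `∫_A f dλ`, where `λ` gives the mass `1/N` to each grid point other than `1`. -/
def integral (N : NSExt ℕ) (A : NSExt (Set ℝ)) (f : NSExt (ℝ → ℝ)) : Hyperreal :=
  Germ.map₂ (fun (p : ℕ × Set ℝ) (g : ℝ → ℝ) => gridIntegral p.1 p.2 g)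
    (Germ.map₂ Prod.mk N A) f

/-- `λ(A)`. -/
def measure (N : NSExt ℕ) (A : NSExt (Set ℝ)) : Hyperreal :=
  integral N A (Germ.const (fun _ : ℝ => (1 : ℝ)))

/-- The internal function `|f|`. -/
def absFun (f : NSExt (ℝ → ℝ)) : NSExt (ℝ → ℝ) :=
  Germ.map (fun (g : ℝ → ℝ) (x : ℝ) => |g x|) f

/-- An external set of grid points is rare if, for every standard `r > 0`, some internal set of
measure at most `r` covers it. -/
def Rare (N : NSExt ℕ) (E : Set Hyperreal) : Prop :=
  ∀ r : ℝ, 0 < r → ∃ B : NSExt (Set ℝ),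
    (∀ x ∈ E, InternalMem x B) ∧ measure N B ≤ (r : Hyperreal)

/-- The grid points that are infinitely close both to a grid point of `A` and to a grid point
outside `A`. -/
def boundary (N : NSExt ℕ) (A : NSExt (Set ℝ)) : Set Hyperreal :=
  {x | x ∈ grid N ∧ (∃ y ∈ grid N, InternalMem y A ∧ y ∈ halo x) ∧
    ∃ z ∈ grid N, ¬ InternalMem z A ∧ z ∈ halo x}

/-- An internal set of grid points is quadrable if its boundary is rare. -/
def Quadrable (N : NSExt ℕ) (A : NSExt (Set ℝ)) : Prop := Rare N (boundary N A)

/-- `S`-integrability of an internal function on the grid. -/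
def SIntegrable (N : NSExt ℕ) (f : NSExt (ℝ → ℝ)) : Prop :=
  Limited (integral N (Germ.const (Set.univ : Set ℝ)) (absFun f)) ∧
    ∀ A : NSExt (Set ℝ), Infinitesimal (measure N A) → Infinitesimal (integral N A (absFun f))

/-- Lebesgue integrability: `S`-integrable, and `S`-continuous outside a rare set. -/
def LebesgueIntegrable (N : NSExt ℕ) (f : NSExt (ℝ → ℝ)) : Prop :=
  SIntegrable N f ∧ ∃ E : Set Hyperreal, Rare N E ∧
    ∀ x ∈ grid N, ∀ y ∈ grid N, x ∉ E → y ∉ E → y ∈ halo x → eval f y ∈ halo (eval f x)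

/-! ### Noises -/

def FastOscillating (N : NSExt ℕ) (f : NSExt (ℝ → ℝ)) : Prop :=
  SIntegrable N f ∧ ∀ A : NSExt (Set ℝ), Quadrable N A → Infinitesimal (integral N A f)

/-- `n` is a noise of mean `m` on the one-dimensional grid. -/
def IsNoise (N : NSExt ℕ) (n m : NSExt (ℝ → ℝ)) : Prop :=
  LebesgueIntegrable N m ∧ SIntegrable N n ∧ FastOscillating N (n - m)

def IsZeroMeanNoise (N : NSExt ℕ) (n : NSExt (ℝ → ℝ)) : Prop := IsNoise N n 0

/-! ### Estimators -/

/-- The internal function `t ↦ ∫_0^t f dλ`, the integral being over the grid points of `[0, t)`. -/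
def primitive (N : NSExt ℕ) (f : NSExt (ℝ → ℝ)) : NSExt (ℝ → ℝ) :=
  Germ.map₂ (fun (M : ℕ) (g : ℝ → ℝ) (t : ℝ) => gridIntegral M (Set.Ico 0 t) g) N f

/-- The internal function `τ ↦ τ ^ ν`. -/
def monomial (ν : ℕ) : NSExt (ℝ → ℝ) := Germ.const (fun x : ℝ => x ^ ν)

/-- The data `c`, `ν`, `k` of a term `c ∫_0^t ⋯ ∫_0^{τ₂} τ₁ ^ ν n(τ₁) dτ₁ ⋯ dτ_k`. A limited
element of `*ℕ` is standard, so `ν` and `k` are in `ℕ`. -/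
structure EstimTerm where
  c : Hyperreal
  ν : ℕ
  k : ℕ

def EstimTerm.Admissible (p : EstimTerm) : Prop := Limited p.c ∧ 1 ≤ p.k

/-- The value at `t` of the `k`-fold iterated integral of `τ ^ ν n(τ)`, multiplied by `c`. -/
def EstimTerm.value (N : NSExt ℕ) (n : NSExt (ℝ → ℝ)) (t : Hyperreal) (p : EstimTerm) : Hyperreal :=
  p.c * eval ((primitive N)^[p.k] (monomial p.ν * n)) t

/-- The relation `δ(t) ([θ]_e(t) - θ) = ∑ c ∫_0^t ⋯ ∫_0^{τ₂} τ₁ ^ ν n(τ₁) dτ₁ ⋯ dτ_k`. -/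
def EstimatorEq (N : NSExt ℕ) (θ : ℝ) (n δ est : NSExt (ℝ → ℝ)) (terms : List EstimTerm)
    (t : Hyperreal) : Prop :=
  eval δ t * (eval est t - (θ : Hyperreal)) = (terms.map (EstimTerm.value N n t)).sum

/-- The standard function `g` on `[0, 1]` is the shadow of the internal function `f`. -/
def IsShadow (N : NSExt ℕ) (f : NSExt (ℝ → ℝ)) (g : ℝ → ℝ) : Prop :=
  ∀ t ∈ grid N, ∀ x ∈ Set.Icc (0 : ℝ) 1, t ∈ halo (x : Hyperreal) →
    eval f t ∈ halo (g x : Hyperreal)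

/-- `d` is the divisor given by `δ`: the shadow of `δ`, analytic on `[0, 1]` and zero at `0`. -/
def IsDivisor (N : NSExt ℕ) (δ : NSExt (ℝ → ℝ)) (d : ℝ → ℝ) : Prop :=
  IsShadow N δ d ∧ AnalyticOn ℝ d (Set.Icc 0 1) ∧ d 0 = 0

end NonstandardNoise

end

noncomputable section

namespace NonstandardNoise

open Filter Topology

/-! ### Germs and representing sequences -/

/-! For part 1, every `[0, s)` with `s` in the grid is quadrable, its boundary lying in the halo of
`s`. Hence a zero-mean noise has an infinitesimal primitive at every grid point. This survives a
weight `τ ^ ν` (Abel summation, `abs_sum_range_mul_le`) and further integrations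
(`GridInfinitesimal.primitive`), so the right side of the estimator relation is infinitesimal. Since
`δ(t)` is infinitely close to a nonzero standard value of the divisor, it can be divided out. An
infinitesimal `t` is excluded because the divisor vanishes at `0`.

For part 2, a unit pulse on the infinitesimal window `[0, t)` has total integral `t`, so it is a
zero-mean noise. With `δ(s) = s` its primitive at `t` equals `δ(t)`, and the estimate there is `θ +
1`. -/

theorem infinitesimal_ofSeq {f : ℕ → ℝ} : Infinitesimal (Hyperreal.ofSeq f) ↔
    ∀ r : ℝ, 0 < r → ∀ᶠ m in (hyperfilter ℕ : Filter ℕ), |f m| < r := by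
  refine forall₂_congr fun r _ => ?_
  rw [abs_lt]
  have h₁ : -(r : Hyperreal) < Hyperreal.ofSeq f ↔ ∀ᶠ m in hyperfilter ℕ, -r < f m :=
    Hyperreal.ofSeq_lt_ofSeq (f := fun _ => -r)
  have h₂ : Hyperreal.ofSeq f < (r : Hyperreal) ↔ ∀ᶠ m in hyperfilter ℕ, f m < r :=
    Hyperreal.ofSeq_lt_ofSeq (g := fun _ => r)
  simp only [abs_lt]
  rw [h₁, h₂, ← eventually_and]

theorem limited_ofSeq_of_eventually {f : ℕ → ℝ} {r : ℝ}
    (h : ∀ᶠ m in (hyperfilter ℕ : Filter ℕ), |f m| ≤ r) : Limited (Hyperreal.ofSeq f) := by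
  refine ⟨r, abs_le.2 ⟨?_, ?_⟩⟩
  · exact Hyperreal.ofSeq_le_ofSeq (f := fun _ => -r) |>.2 (h.mono fun m hm => (abs_le.1 hm).1)
  · exact Hyperreal.ofSeq_le_ofSeq (g := fun _ => r) |>.2 (h.mono fun m hm => (abs_le.1 hm).2)

theorem ofSeq_mem_halo {f g : ℕ → ℝ} : Hyperreal.ofSeq f ∈ halo (Hyperreal.ofSeq g) ↔
    ∀ r : ℝ, 0 < r → ∀ᶠ m in (hyperfilter ℕ : Filter ℕ), |f m - g m| < r :=
  infinitesimal_ofSeq (f := fun m => f m - g m)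

theorem ofSeq_congr {f g : ℕ → ℝ} (h : ∀ᶠ m in (hyperfilter ℕ : Filter ℕ), f m = g m) :
    Hyperreal.ofSeq f = Hyperreal.ofSeq g :=
  Germ.coe_eq.2 h

theorem eventually_lt_of_unlimited {M : ℕ → ℕ}
    (h : Unlimited (M : Germ (hyperfilter ℕ : Filter ℕ) ℕ)) (b : ℕ) :
    ∀ᶠ m in (hyperfilter ℕ : Filter ℕ), b < M m :=
  Germ.coe_lt.1 (h b)

/-- Truncating with `min` gives a representative whose bound holds at every index, not just almost
everywhere. -/
theorem mem_grid_coe {M : ℕ → ℕ} {t : Hyperreal} :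
    t ∈ grid (M : Germ (hyperfilter ℕ : Filter ℕ) ℕ) ↔
      ∃ k : ℕ → ℕ, (∀ m, k m ≤ M m) ∧ t = Hyperreal.ofSeq fun m => (k m : ℝ) / (M m : ℝ) := by
  constructor
  · rintro ⟨k, hk, rfl⟩
    induction k using Germ.inductionOn with
    | h k =>
      refine ⟨fun m => min (k m) (M m), fun m => min_le_right _ _, ?_⟩
      refine ofSeq_congr (f := fun m => (k m : ℝ) / (M m : ℝ)) ?_
      filter_upwards [Germ.coe_le.1 hk] with m hm
      rw [min_eq_left hm]
  · rintro ⟨k, hk, rfl⟩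
    exact ⟨(k : Germ (hyperfilter ℕ : Filter ℕ) ℕ), Germ.coe_le.2 (Eventually.of_forall hk), rfl⟩

/-! ### Infinitesimals -/

theorem Infinitesimal.zero : Infinitesimal 0 := fun r hr => by
  rw [abs_zero]; exact Hyperreal.coe_pos.2 hr

theorem Infinitesimal.add {x y : Hyperreal} (hx : Infinitesimal x) (hy : Infinitesimal y) :
    Infinitesimal (x + y) := fun r hr => by
  have h := add_lt_add (hx (r / 2) (half_pos hr)) (hy (r / 2) (half_pos hr))
  rw [← Hyperreal.coe_add, add_halves] at h
  exact (abs_add_le x y).trans_lt h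

theorem Infinitesimal.limited {x : Hyperreal} (hx : Infinitesimal x) : Limited x :=
  ⟨1, (hx 1 one_pos).le⟩

theorem Limited.mul_infinitesimal {c x : Hyperreal} (hc : Limited c) (hx : Infinitesimal x) :
    Infinitesimal (c * x) := fun r hr => by
  obtain ⟨b, hb⟩ := hc
  have hb' : (b : Hyperreal) ≤ ((|b| + 1 : ℝ) : Hyperreal) :=
    Hyperreal.coe_le_coe.2 (by linarith [le_abs_self b])
  have hpos : 0 < |b| + 1 := by positivity
  calc |c * x| = |c| * |x| := abs_mul c x
    _ ≤ ((|b| + 1 : ℝ) : Hyperreal) * |x| :=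
      mul_le_mul_of_nonneg_right (hb.trans hb') (abs_nonneg x)
    _ < ((|b| + 1 : ℝ) : Hyperreal) * ((r / (|b| + 1) : ℝ) : Hyperreal) :=
      mul_lt_mul_of_pos_left (hx _ (div_pos hr hpos)) (Hyperreal.coe_pos.2 hpos)
    _ = r := by rw [← Hyperreal.coe_mul, mul_div_cancel₀ _ hpos.ne']

theorem Infinitesimal.list_sum {l : List Hyperreal} (h : ∀ x ∈ l, Infinitesimal x) :
    Infinitesimal l.sum := by
  induction l with
  | nil => exact Infinitesimal.zero
  | cons a l ih =>
    rw [List.sum_cons]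
    exact (h a List.mem_cons_self).add (ih fun x hx => h x (List.mem_cons_of_mem a hx))

/-- If `x y` is infinitesimal and `x` is infinitely close to a nonzero standard real, then `y` is
infinitesimal. -/
theorem Infinitesimal.of_mul_left {x y : Hyperreal} {a : ℝ} (h : Infinitesimal (x * y))
    (hx : x ∈ halo (a : Hyperreal)) (ha : a ≠ 0) : Infinitesimal y := by
  have hpos : 0 < |a| := abs_pos.2 ha
  have hclose := hx (|a| / 2) (half_pos hpos)
  -- Staying above `|a| / 2` in absolute value makes the inverse of `x` limited.
  have hlow : ((|a| / 2 : ℝ) : Hyperreal) < |x| := by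
    have h₁ : ((|a| : ℝ) : Hyperreal) ≤ |x| + |x - a| := by
      rw [Hyperreal.coe_abs]
      calc |(a : Hyperreal)| = |x - (x - a)| := by rw [sub_sub_cancel]
        _ ≤ |x| + |x - a| := abs_sub _ _
    have h₂ : ((|a| : ℝ) : Hyperreal) = ((|a| / 2 : ℝ) : Hyperreal) + ((|a| / 2 : ℝ) : Hyperreal) := by
      rw [← Hyperreal.coe_add, add_halves]
    rw [h₂] at h₁
    linarith
  have hx0 : x ≠ 0 := by
    rintro rfl
    rw [abs_zero] at hlow
    exact absurd (Hyperreal.coe_pos.2 (half_pos hpos)) hlow.not_gt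
  have hinv : Limited x⁻¹ := by
    refine ⟨(|a| / 2)⁻¹, ?_⟩
    rw [abs_inv, Hyperreal.coe_inv]
    exact inv_anti₀ (Hyperreal.coe_pos.2 (half_pos hpos)) hlow.le
  have := hinv.mul_infinitesimal h
  rwa [inv_mul_cancel_left₀ hx0] at this

/-- Every grid point has a standard part in `[0, 1]`. -/
theorem exists_mem_halo_of_mem_grid {N : NSExt ℕ} {t : Hyperreal} (ht : t ∈ grid N) :
    ∃ x ∈ Set.Icc (0 : ℝ) 1, t ∈ halo (x : Hyperreal) := by
  induction N using Germ.inductionOn with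
  | h M =>
    obtain ⟨k, hk, rfl⟩ := mem_grid_coe.1 ht
    set u : ℕ → ℝ := fun m => (k m : ℝ) / (M m : ℝ) with hu
    have hmem : ∀ m, u m ∈ Set.Icc (0 : ℝ) 1 := fun m =>
      ⟨by positivity, div_le_one_of_le₀ (Nat.cast_le.2 (hk m)) (Nat.cast_nonneg _)⟩
    -- The standard part is the limit of the representing sequence along the ultrafilter, which
    -- exists by compactness.
    obtain ⟨x, hx, hlim⟩ := (isCompact_Icc (a := (0 : ℝ)) (b := 1)).ultrafilter_le_nhds
      ((hyperfilter ℕ).map u)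
      (le_principal_iff.2 (Ultrafilter.mem_map.2 (univ_mem' hmem)))
    refine ⟨x, hx, ofSeq_mem_halo (g := fun _ => x) |>.2 fun r hr => ?_⟩
    have : Tendsto u (hyperfilter ℕ) (𝓝 x) := hlim
    exact (Metric.tendsto_nhds.1 this r hr).mono fun m hm => by rwa [Real.dist_eq] at hm

theorem nonneg_of_mem_grid {N : NSExt ℕ} {t : Hyperreal} (ht : t ∈ grid N) : 0 ≤ t := by
  induction N using Germ.inductionOn with
  | h M =>
    obtain ⟨k, hk, rfl⟩ := mem_grid_coe.1 ht
    exact Hyperreal.ofSeq_le_ofSeq (f := fun _ => 0) |>.2 (Eventually.of_forall fun m => by positivity)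

theorem limited_of_mem_grid {N : NSExt ℕ} {t : Hyperreal} (ht : t ∈ grid N) : Limited t := by
  induction N using Germ.inductionOn with
  | h M =>
    obtain ⟨k, hk, rfl⟩ := mem_grid_coe.1 ht
    refine limited_ofSeq_of_eventually (r := 1) (Eventually.of_forall fun m => ?_)
    rw [abs_of_nonneg (by positivity)]
    exact div_le_one_of_le₀ (Nat.cast_le.2 (hk m)) (Nat.cast_nonneg _)

/-! ### Finite grid sums -/

theorem gridIntegral_eq_zero {M : ℕ} {A : Set ℝ} {g : ℝ → ℝ}
    (h : ∀ k < M, (k : ℝ) / (M : ℝ) ∈ A → g ((k : ℝ) / (M : ℝ)) = 0) : gridIntegral M A g = 0 := by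
  classical
  refine Finset.sum_eq_zero fun k hk => ?_
  rw [Set.indicator_apply]
  split_ifs with hA
  · rw [h k (Finset.mem_range.1 hk) hA, zero_div]
  · exact zero_div _

theorem gridIntegral_Ico {M k : ℕ} (hk : k ≤ M) (g : ℝ → ℝ) :
    gridIntegral M (Set.Ico 0 ((k : ℝ) / (M : ℝ))) g =
      ∑ j ∈ Finset.range k, g ((j : ℝ) / (M : ℝ)) / (M : ℝ) := by
  rcases Nat.eq_zero_or_pos M with rfl | hM
  · obtain rfl : k = 0 := by omega
    simp [gridIntegral]
  have hM' : (0 : ℝ) < M := Nat.cast_pos.2 hM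
  have hmem : ∀ j : ℕ, (j : ℝ) / (M : ℝ) ∈ Set.Ico (0 : ℝ) ((k : ℝ) / (M : ℝ)) ↔ j < k := fun j => by
    rw [Set.mem_Ico, div_lt_div_iff_of_pos_right hM', Nat.cast_lt]
    exact and_iff_right (by positivity)
  unfold gridIntegral
  rw [← Finset.sum_subset (Finset.range_subset_range.2 hk)]
  · refine Finset.sum_congr rfl fun j hj => ?_
    rw [Set.indicator_of_mem ((hmem j).2 (Finset.mem_range.1 hj))]
  · intro j _ hj
    rw [Set.indicator_of_notMem (fun h => hj (Finset.mem_range.2 ((hmem j).1 h))), zero_div]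

/-- Only indices within `⌊M ε⌋` of `k` contribute: at most `2 ⌊M ε⌋ + 1` points of mass `1 / M`. -/
theorem gridIntegral_const_one_Icc_le {M k : ℕ} {ε : ℝ} (hM : 0 < M) (hε : 0 ≤ ε) :
    gridIntegral M (Set.Icc ((k : ℝ) / M - ε) ((k : ℝ) / M + ε)) (fun _ => 1) ≤
      2 * ε + 1 / (M : ℝ) := by
  classical
  have hM' : (0 : ℝ) < M := Nat.cast_pos.2 hM
  set e : ℕ := ⌊(M : ℝ) * ε⌋₊ with he
  have hsum : gridIntegral M (Set.Icc ((k : ℝ) / M - ε) ((k : ℝ) / M + ε)) (fun _ => 1) ≤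
      ∑ j ∈ Finset.Icc (k - e) (k + e), 1 / (M : ℝ) := by
    have hstep : ∀ j ∈ Finset.range M,
        (Set.Icc ((k : ℝ) / M - ε) ((k : ℝ) / M + ε)).indicator (fun _ => (1 : ℝ)) ((j : ℝ) / M) / M ≤
          if j ∈ Finset.Icc (k - e) (k + e) then 1 / (M : ℝ) else 0 := by
      intro j _
      rw [Set.indicator_apply]
      by_cases hj : (j : ℝ) / M ∈ Set.Icc ((k : ℝ) / M - ε) ((k : ℝ) / M + ε)
      · rw [if_pos hj, if_pos]
        obtain ⟨h₁, h₂⟩ := hj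
        rw [tsub_le_iff_right, div_add' _ _ _ hM'.ne', div_le_div_iff_of_pos_right hM'] at h₁
        rw [div_add' _ _ _ hM'.ne', div_le_div_iff_of_pos_right hM'] at h₂
        rw [Finset.mem_Icc]
        constructor
        · have : k - j ≤ e := by
            refine Nat.le_floor ?_
            rcases le_total k j with h | h
            · rw [Nat.sub_eq_zero_of_le h, Nat.cast_zero]; positivity
            · rw [Nat.cast_sub h]; linarith
          omega
        · have : j - k ≤ e := by
            refine Nat.le_floor ?_
            rcases le_total j k with h | h
            · rw [Nat.sub_eq_zero_of_le h, Nat.cast_zero]; positivity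
            · rw [Nat.cast_sub h]; linarith
          omega
      · rw [if_neg hj, zero_div]
        split_ifs <;> positivity
    refine (Finset.sum_le_sum hstep).trans ?_
    rw [← Finset.sum_filter]
    refine Finset.sum_le_sum_of_subset_of_nonneg (fun j hj => (Finset.mem_filter.1 hj).2)
      fun j _ _ => by positivity
  refine hsum.trans ?_
  rw [Finset.sum_const, Nat.card_Icc, nsmul_eq_mul]
  have hcard : ((k + e + 1 - (k - e) : ℕ) : ℝ) ≤ 2 * (M * ε) + 1 := by
    have h₁ : k + e + 1 - (k - e) ≤ 2 * e + 1 := by omega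
    have h₂ : (e : ℝ) ≤ M * ε := Nat.floor_le (by positivity)
    calc ((k + e + 1 - (k - e) : ℕ) : ℝ) ≤ ((2 * e + 1 : ℕ) : ℝ) := Nat.cast_le.2 h₁
      _ = 2 * e + 1 := by push_cast; ring
      _ ≤ _ := by linarith
  calc _ ≤ (2 * (M * ε) + 1) * (1 / (M : ℝ)) := mul_le_mul_of_nonneg_right hcard (by positivity)
    _ = 2 * ε + 1 / (M : ℝ) := by field_simp

theorem gridIntegral_abs_le_of_subset {M : ℕ} {A B : Set ℝ} (hAB : A ⊆ B) (g : ℝ → ℝ) :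
    |gridIntegral M A g| ≤ gridIntegral M B fun x => |g x| := by
  refine (Finset.abs_sum_le_sum_abs _ _).trans (Finset.sum_le_sum fun k _ => ?_)
  rw [abs_div, Nat.abs_cast]
  refine div_le_div_of_nonneg_right ?_ (Nat.cast_nonneg M)
  by_cases hA : (k : ℝ) / (M : ℝ) ∈ A
  · rw [Set.indicator_of_mem hA, Set.indicator_of_mem (hAB hA)]
  · rw [Set.indicator_of_notMem hA, abs_zero]
    exact Set.indicator_nonneg (fun x _ => abs_nonneg (g x)) _

/-- Abel's inequality for a monotone weight with values in `[0, 1]`. -/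
theorem abs_sum_range_mul_le {a b : ℕ → ℝ} {K : ℕ} {r : ℝ} (ha : Monotone a) (ha₀ : 0 ≤ a 0)
    (haK : a K ≤ 1) (hb : ∀ k ≤ K, |∑ j ∈ Finset.range k, b j| ≤ r) :
    |∑ j ∈ Finset.range K, a j * b j| ≤ 2 * r := by
  have hparts : ∀ k : ℕ, ∑ j ∈ Finset.range k, a j * b j =
      a k * ∑ j ∈ Finset.range k, b j -
        ∑ j ∈ Finset.range k, (a (j + 1) - a j) * ∑ i ∈ Finset.range (j + 1), b i := by
    intro k
    induction k with
    | zero => simp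
    | succ k ih =>
      rw [Finset.sum_range_succ, ih, Finset.sum_range_succ _ k, Finset.sum_range_succ _ k]
      rw [Finset.sum_range_succ b k]
      ring
  have hr : 0 ≤ r := (abs_nonneg _).trans (hb 0 (Nat.zero_le K))
  have hnonneg : 0 ≤ a K := ha₀.trans (ha (Nat.zero_le K))
  rw [hparts K]
  -- The boundary term and the telescoping variation `a K - a 0 ≤ 1` each cost at most `r`.
  refine (abs_sub _ _).trans ?_
  have h₁ : |a K * ∑ j ∈ Finset.range K, b j| ≤ r := by
    rw [abs_mul, abs_of_nonneg hnonneg]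
    calc a K * |∑ j ∈ Finset.range K, b j| ≤ 1 * r :=
          mul_le_mul haK (hb K le_rfl) (abs_nonneg _) zero_le_one
      _ = r := one_mul r
  have h₂ : |∑ j ∈ Finset.range K, (a (j + 1) - a j) * ∑ i ∈ Finset.range (j + 1), b i| ≤ r := by
    calc _ ≤ ∑ j ∈ Finset.range K, (a (j + 1) - a j) * r := by
          refine (Finset.abs_sum_le_sum_abs _ _).trans (Finset.sum_le_sum fun j hj => ?_)
          have hd : 0 ≤ a (j + 1) - a j := sub_nonneg.2 (ha (Nat.le_succ j))
          rw [abs_mul, abs_of_nonneg hd]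
          exact mul_le_mul_of_nonneg_left (hb _ (Finset.mem_range.1 hj)) hd
      _ = (a K - a 0) * r := by rw [← Finset.sum_mul, Finset.sum_range_sub]
      _ ≤ 1 * r := mul_le_mul_of_nonneg_right (by linarith) hr
      _ = r := one_mul r
  linarith

/-! ### Internal functions that are infinitesimal on the whole grid -/

def GridInfinitesimal (N : NSExt ℕ) (f : NSExt (ℝ → ℝ)) : Prop :=
  ∀ s ∈ grid N, Infinitesimal (eval f s)

/-- Pointwise smallness is automatically uniform: points maximizing `|f m|` on the finite grids form
a single hyperfinite grid point, where the hypothesis applies. -/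
theorem gridInfinitesimal_coe {M : ℕ → ℕ} {f : ℕ → ℝ → ℝ} :
    GridInfinitesimal (M : Germ (hyperfilter ℕ : Filter ℕ) ℕ)
        (f : Germ (hyperfilter ℕ : Filter ℕ) (ℝ → ℝ)) ↔
      ∀ r : ℝ, 0 < r → ∀ᶠ m in (hyperfilter ℕ : Filter ℕ),
        ∀ k ≤ M m, |f m ((k : ℝ) / (M m : ℝ))| < r := by
  constructor
  · intro h r hr
    have hmax : ∀ m, ∃ k ≤ M m, ∀ j ≤ M m,
        |f m ((j : ℝ) / (M m : ℝ))| ≤ |f m ((k : ℝ) / (M m : ℝ))| := fun m => by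
      obtain ⟨k, hk, hmax⟩ := Finset.exists_max_image (Finset.range (M m + 1))
        (fun k : ℕ => |f m ((k : ℝ) / (M m : ℝ))|) ⟨0, Finset.mem_range.2 (Nat.succ_pos _)⟩
      exact ⟨k, Nat.lt_succ_iff.1 (Finset.mem_range.1 hk),
        fun j hj => hmax j (Finset.mem_range.2 (Nat.lt_succ_iff.2 hj))⟩
    choose k hk hkmax using hmax
    have hinf : Infinitesimal (Hyperreal.ofSeq fun m => f m ((k m : ℝ) / (M m : ℝ))) :=
      h _ (mem_grid_coe.2 ⟨k, hk, rfl⟩)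
    filter_upwards [infinitesimal_ofSeq.1 hinf r hr] with m hm j hj
    exact (hkmax m j hj).trans_lt hm
  · intro h s hs
    obtain ⟨k, hk, rfl⟩ := mem_grid_coe.1 hs
    refine infinitesimal_ofSeq (f := fun m => f m ((k m : ℝ) / (M m : ℝ))) |>.2 fun r hr => ?_
    filter_upwards [h r hr] with m hm
    exact hm _ (hk m)

/-- A uniform bound on the integrand passes to the primitive because the total mass is at most `1`.
-/
theorem GridInfinitesimal.primitive {N : NSExt ℕ} {f : NSExt (ℝ → ℝ)}
    (h : GridInfinitesimal N f) : GridInfinitesimal N (primitive N f) := by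
  induction N, f using Germ.inductionOn₂ with
  | h M f =>
    refine gridInfinitesimal_coe
      (f := fun m t => gridIntegral (M m) (Set.Ico 0 t) (f m)) |>.2 fun r hr => ?_
    filter_upwards [gridInfinitesimal_coe.1 h (r / 2) (half_pos hr)] with m hm k hk
    rw [gridIntegral_Ico hk]
    have hbound : |∑ j ∈ Finset.range k, f m ((j : ℝ) / (M m : ℝ)) / (M m : ℝ)| ≤
        ∑ j ∈ Finset.range k, (r / 2) / (M m : ℝ) := by
      refine (Finset.abs_sum_le_sum_abs _ _).trans (Finset.sum_le_sum fun j hj => ?_)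
      rw [abs_div, Nat.abs_cast]
      exact div_le_div_of_nonneg_right
        (hm j ((Finset.mem_range.1 hj).le.trans hk)).le (Nat.cast_nonneg _)
    refine hbound.trans_lt ?_
    rw [Finset.sum_const, Finset.card_range, nsmul_eq_mul]
    calc (k : ℝ) * ((r / 2) / (M m : ℝ)) = (k : ℝ) / (M m : ℝ) * (r / 2) := by ring
      _ ≤ 1 * (r / 2) := mul_le_mul_of_nonneg_right
          (div_le_one_of_le₀ (Nat.cast_le.2 hk) (Nat.cast_nonneg _)) (half_pos hr).le
      _ < r := by linarith

theorem GridInfinitesimal.primitive_iterate {N : NSExt ℕ} {f : NSExt (ℝ → ℝ)}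
    (h : GridInfinitesimal N f) (k : ℕ) :
    GridInfinitesimal N ((NonstandardNoise.primitive N)^[k] f) := by
  induction k with
  | zero => exact h
  | succ k ih =>
    rw [Function.iterate_succ_apply']
    exact ih.primitive

theorem GridInfinitesimal.primitive_monomial_mul {N : NSExt ℕ} {n : NSExt (ℝ → ℝ)}
    (h : GridInfinitesimal N (NonstandardNoise.primitive N n)) (ν : ℕ) :
    GridInfinitesimal N (NonstandardNoise.primitive N (monomial ν * n)) := by
  induction N, n using Germ.inductionOn₂ with
  | h M n =>
    refine gridInfinitesimal_coe
      (f := fun m t => gridIntegral (M m) (Set.Ico 0 t) fun x => x ^ ν * n m x) |>.2 fun r hr => ?_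
    have h' := gridInfinitesimal_coe (f := fun m t => gridIntegral (M m) (Set.Ico 0 t) (n m)) |>.1 h
    -- Abel's inequality doubles the bound, and `2 * (r / 3) < r`.
    filter_upwards [h' (r / 3) (by positivity)] with m hm k hk
    have hm' : ∀ j ≤ k, |∑ i ∈ Finset.range j, n m ((i : ℝ) / (M m : ℝ)) / (M m : ℝ)| ≤ r / 3 :=
      fun j hj => by
        have := hm j (hj.trans hk)
        rw [gridIntegral_Ico (hj.trans hk)] at this
        exact this.le
    have hmono : Monotone fun j : ℕ => ((j : ℝ) / (M m : ℝ)) ^ ν := fun i j hij =>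
      pow_le_pow_left₀ (by positivity)
        (div_le_div_of_nonneg_right (Nat.cast_le.2 hij) (Nat.cast_nonneg _)) ν
    have hone : ((k : ℝ) / (M m : ℝ)) ^ ν ≤ 1 :=
      pow_le_one₀ (by positivity) (div_le_one_of_le₀ (Nat.cast_le.2 hk) (Nat.cast_nonneg _))
    have key := abs_sum_range_mul_le hmono (by positivity) hone hm'
    rw [gridIntegral_Ico hk]
    simp only [mul_div_assoc]
    exact key.trans_lt (by linarith)

/-! ### Zero-mean noises -/

/-- The initial segment `[0, t)` as an internal set. -/
def initialSegment (t : Hyperreal) : NSExt (Set ℝ) := Germ.map (fun x : ℝ => Set.Ico 0 x) t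

theorem internalMem_initialSegment {s t : Hyperreal} :
    InternalMem s (initialSegment t) ↔ 0 ≤ s ∧ s < t := by
  obtain ⟨f, rfl⟩ := Hyperreal.ofSeq_surjective s
  obtain ⟨g, rfl⟩ := Hyperreal.ofSeq_surjective t
  have h₁ : 0 ≤ Hyperreal.ofSeq f ↔ ∀ᶠ m in hyperfilter ℕ, 0 ≤ f m :=
    Hyperreal.ofSeq_le_ofSeq (f := fun _ => 0)
  rw [h₁, Hyperreal.ofSeq_lt_ofSeq, ← eventually_and]
  rfl

theorem quadrable_initialSegment {N : NSExt ℕ} (hN : Unlimited N) {t : Hyperreal}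
    (ht : t ∈ grid N) : Quadrable N (initialSegment t) := by
  intro r hr
  -- A boundary point is infinitely close to some `y < t` and some `z ≥ t`, hence to `t`.
  have hclose : ∀ x ∈ boundary N (initialSegment t), Infinitesimal (x - t) := by
    rintro x ⟨-, ⟨y, -, hy, hyx⟩, z, hz, hzt, hzx⟩
    have hyt := (internalMem_initialSegment.1 hy).2
    have htz : t ≤ z := not_lt.1 fun h => hzt (internalMem_initialSegment.2 ⟨nonneg_of_mem_grid hz, h⟩)
    intro r hr
    have h₁ := abs_lt.1 (hyx r hr)
    have h₂ := abs_lt.1 (hzx r hr)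
    exact abs_lt.2 ⟨by linarith, by linarith⟩
  induction N using Germ.inductionOn with
  | h M =>
    obtain ⟨k, hk, rfl⟩ := mem_grid_coe.1 ht
    -- Radius `r / 4` uses up measure `r / 2`; the other half absorbs the counting error `1 / M`,
    -- small because `N` is unlimited.
    refine ⟨((fun m => Set.Icc ((k m : ℝ) / M m - r / 4) ((k m : ℝ) / M m + r / 4) :
      ℕ → Set ℝ) : Germ (hyperfilter ℕ : Filter ℕ) (Set ℝ)), fun x hx => ?_, ?_⟩
    · have hx' := hclose x hx
      obtain ⟨f, rfl⟩ := Hyperreal.ofSeq_surjective x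
      refine Germ.liftRel_coe.2 ?_
      filter_upwards [infinitesimal_ofSeq (f := fun m => f m - (k m : ℝ) / M m) |>.1 hx' (r / 4)
        (by positivity)] with m hm
      obtain ⟨h₁, h₂⟩ := abs_lt.1 hm
      exact ⟨by linarith, by linarith⟩
    · refine Hyperreal.ofSeq_le_ofSeq (g := fun _ => r) |>.2 ?_
      obtain ⟨b, hb⟩ := exists_nat_gt (2 / r)
      filter_upwards [eventually_lt_of_unlimited hN b] with m hm
      have hpos : 0 < M m := (Nat.zero_le b).trans_lt hm
      refine (gridIntegral_const_one_Icc_le hpos (by positivity)).trans ?_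
      have hbM : 2 / r < (M m : ℝ) := hb.trans (Nat.cast_lt.2 hm)
      have : 1 / (M m : ℝ) ≤ r / 2 := by
        rw [div_lt_iff₀ hr] at hbM
        rw [div_le_div_iff₀ (Nat.cast_pos.2 hpos) two_pos]
        linarith
      linarith

theorem IsZeroMeanNoise.gridInfinitesimal_primitive {N : NSExt ℕ} (hN : Unlimited N)
    {n : NSExt (ℝ → ℝ)} (hn : IsZeroMeanNoise N n) : GridInfinitesimal N (primitive N n) := by
  intro s hs
  have h := hn.2.2.2 _ (quadrable_initialSegment hN hs)
  rw [sub_zero] at h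
  obtain ⟨f, rfl⟩ := Hyperreal.ofSeq_surjective s
  induction N, n using Germ.inductionOn₂ with
  | h M n => exact h

theorem IsZeroMeanNoise.infinitesimal_value {N : NSExt ℕ} (hN : Unlimited N)
    {n : NSExt (ℝ → ℝ)} (hn : IsZeroMeanNoise N n) {p : EstimTerm} (hp : p.Admissible)
    {t : Hyperreal} (ht : t ∈ grid N) : Infinitesimal (p.value N n t) := by
  obtain ⟨hc, hk⟩ := hp
  refine hc.mul_infinitesimal ?_
  -- One integration is split off to make the noise infinitesimal; the noise itself need not be.
  obtain ⟨k, hk'⟩ := Nat.exists_eq_add_of_le' hk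
  rw [hk', Function.iterate_succ_apply]
  exact ((hn.gridInfinitesimal_primitive hN).primitive_monomial_mul p.ν).primitive_iterate k t ht

theorem estimator_mem_halo {N : NSExt ℕ} (hN : Unlimited N) {θ : ℝ} {n δ est : NSExt (ℝ → ℝ)}
    {d : ℝ → ℝ} {terms : List EstimTerm} (hn : IsZeroMeanNoise N n) (hδ : IsDivisor N δ d)
    (hterms : ∀ p ∈ terms, p.Admissible) {t : Hyperreal} (ht : t ∈ grid N)
    (heq : EstimatorEq N θ n δ est terms t)
    (hzero : ∀ z ∈ Set.Icc (0 : ℝ) 1, d z = 0 → t ∉ halo (z : Hyperreal)) :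
    eval est t ∈ halo (θ : Hyperreal) := by
  obtain ⟨x, hx, htx⟩ := exists_mem_halo_of_mem_grid ht
  have hsum : Infinitesimal (eval δ t * (eval est t - (θ : Hyperreal))) := by
    rw [show eval δ t * (eval est t - (θ : Hyperreal)) = _ from heq]
    refine Infinitesimal.list_sum fun y hy => ?_
    obtain ⟨p, hp, rfl⟩ := List.mem_map.1 hy
    exact hn.infinitesimal_value hN (hterms p hp) ht
  exact hsum.of_mul_left (hδ.1 t ht x hx htx) fun h => hzero x hx h htx

/-! ### A noise that defeats an infinitesimal window -/

/-- An internal function whose total absolute integral is infinitesimal is a zero-mean noise. -/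
theorem isZeroMeanNoise_of_infinitesimal_integral {N : NSExt ℕ} {n : NSExt (ℝ → ℝ)}
    (h : Infinitesimal (integral N (Germ.const Set.univ) (absFun n))) : IsZeroMeanNoise N n := by
  have habs : ∀ A : NSExt (Set ℝ), Infinitesimal (integral N A n) ∧
      Infinitesimal (integral N A (absFun n)) := by
    intro A
    induction N, n, A using Germ.inductionOn₃ with
    | H M n A =>
      have h' := infinitesimal_ofSeq
        (f := fun m => gridIntegral (M m) Set.univ fun x => |n m x|) |>.1 h
      constructor
      · refine infinitesimal_ofSeq (f := fun m => gridIntegral (M m) (A m) (n m)) |>.2 fun r hr => ?_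
        filter_upwards [h' r hr] with m hm
        exact (gridIntegral_abs_le_of_subset (Set.subset_univ _) _).trans_lt
          ((le_abs_self _).trans_lt hm)
      · refine infinitesimal_ofSeq
          (f := fun m => gridIntegral (M m) (A m) fun x => |n m x|) |>.2 fun r hr => ?_
        filter_upwards [h' r hr] with m hm
        refine (gridIntegral_abs_le_of_subset (Set.subset_univ _) _).trans_lt ?_
        simp only [abs_abs]
        exact (le_abs_self _).trans_lt hm
  have hS : SIntegrable N n := ⟨h.limited, fun A _ => (habs A).2⟩
  have hzero : ∀ A : NSExt (Set ℝ), integral N A (absFun 0) = 0 := by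
    intro A
    induction N, A using Germ.inductionOn₂ with
    | h M A =>
      refine ofSeq_congr (f := fun m => gridIntegral (M m) (A m) fun x => |(0 : ℝ → ℝ) x|)
        (g := fun _ => 0) (Eventually.of_forall fun m => ?_)
      exact gridIntegral_eq_zero fun k _ _ => abs_zero
  -- The zero mean is `S`-continuous everywhere, so the exceptional rare set is empty.
  refine ⟨⟨⟨?_, fun A _ => ?_⟩, ∅, fun r hr => ⟨Germ.const ∅, fun x hx => hx.elim, ?_⟩, ?_⟩, hS, ?_⟩
  · rw [hzero]; exact Infinitesimal.zero.limited
  · rw [hzero]; exact Infinitesimal.zero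
  · induction N using Germ.inductionOn with
    | h M =>
      refine Hyperreal.ofSeq_le_ofSeq (f := fun m => gridIntegral (M m) ∅ fun _ => 1)
        (g := fun _ => r) |>.2 (Eventually.of_forall fun m => ?_)
      rw [gridIntegral_eq_zero fun k _ hk => hk.elim]
      exact hr.le
  · intro x _ y _ _ _ _
    have hev : ∀ z : Hyperreal, eval 0 z = 0 := fun z => by
      obtain ⟨f, rfl⟩ := Hyperreal.ofSeq_surjective z
      rfl
    change Infinitesimal (eval 0 y - eval 0 x)
    rw [hev, hev, sub_zero]
    exact Infinitesimal.zero
  · rw [sub_zero]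
    exact ⟨hS, fun A _ => (habs A).1⟩

/-- The indicator function of `[0, t)`. -/
def pulse (t : Hyperreal) : NSExt (ℝ → ℝ) :=
  Germ.map (fun x : ℝ => (Set.Ico 0 x).indicator fun _ => (1 : ℝ)) t

theorem gridIntegral_pulse {M k : ℕ} (hk : k ≤ M) {A : Set ℝ}
    (hA : Set.Ico 0 ((k : ℝ) / (M : ℝ)) ⊆ A) :
    gridIntegral M A ((Set.Ico 0 ((k : ℝ) / (M : ℝ))).indicator fun _ => 1) = (k : ℝ) / M := by
  have h : gridIntegral M A ((Set.Ico 0 ((k : ℝ) / (M : ℝ))).indicator fun _ => 1) =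
      gridIntegral M (Set.Ico 0 ((k : ℝ) / (M : ℝ))) fun _ => 1 := by
    unfold gridIntegral
    rw [Set.indicator_indicator, Set.inter_eq_right.2 hA]
  rw [h, gridIntegral_Ico hk, Finset.sum_const, Finset.card_range, nsmul_eq_mul, mul_one_div]

theorem isZeroMeanNoise_pulse {N : NSExt ℕ} {t : Hyperreal} (ht : t ∈ grid N)
    (hinf : Infinitesimal t) : IsZeroMeanNoise N (pulse t) := by
  refine isZeroMeanNoise_of_infinitesimal_integral ?_
  suffices h : integral N (Germ.const Set.univ) (absFun (pulse t)) = t by rwa [h]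
  induction N using Germ.inductionOn with
  | h M =>
    obtain ⟨k, hk, rfl⟩ := mem_grid_coe.1 ht
    refine ofSeq_congr (f := fun m => gridIntegral (M m) Set.univ fun x =>
      |(Set.Ico 0 ((k m : ℝ) / M m)).indicator (fun _ => (1 : ℝ)) x|)
      (Eventually.of_forall fun m => ?_)
    have habs : (fun x => |(Set.Ico 0 ((k m : ℝ) / M m)).indicator (fun _ => (1 : ℝ)) x|) =
        (Set.Ico 0 ((k m : ℝ) / M m)).indicator fun _ => 1 := funext fun x =>
      abs_of_nonneg (Set.indicator_nonneg (fun _ _ => zero_le_one) x)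
    simp only [habs]
    exact gridIntegral_pulse (hk m) (Set.subset_univ _)

theorem eval_primitive_pulse_self {N : NSExt ℕ} {t : Hyperreal} (ht : t ∈ grid N) :
    eval (primitive N (pulse t)) t = t := by
  induction N using Germ.inductionOn with
  | h M =>
    obtain ⟨k, hk, rfl⟩ := mem_grid_coe.1 ht
    exact ofSeq_congr (f := fun m => gridIntegral (M m) (Set.Ico 0 ((k m : ℝ) / M m))
      ((Set.Ico 0 ((k m : ℝ) / M m)).indicator fun _ => (1 : ℝ)))
      (Eventually.of_forall fun m => gridIntegral_pulse (hk m) Set.Subset.rfl)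

theorem eval_primitive_zero (N : NSExt ℕ) (f : NSExt (ℝ → ℝ)) : eval (primitive N f) 0 = 0 := by
  induction N, f using Germ.inductionOn₂ with
  | h M f =>
    exact ofSeq_congr (f := fun m => gridIntegral (M m) (Set.Ico 0 0) (f m)) (g := fun _ => 0)
      (Eventually.of_forall fun m => gridIntegral_eq_zero fun k _ hk =>
        absurd hk.2 hk.1.not_gt)

theorem eval_const_id (t : Hyperreal) : eval (Germ.const fun x : ℝ => x) t = t := by
  obtain ⟨f, rfl⟩ := Hyperreal.ofSeq_surjective t
  rfl

/-- The internal function `s ↦ θ + f s / s`. -/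
def addDivId (θ : ℝ) (f : NSExt (ℝ → ℝ)) : NSExt (ℝ → ℝ) :=
  Germ.map (fun (g : ℝ → ℝ) (x : ℝ) => θ + g x / x) f

theorem eval_addDivId (θ : ℝ) (f : NSExt (ℝ → ℝ)) (t : Hyperreal) :
    eval (addDivId θ f) t = θ + eval f t / t := by
  obtain ⟨u, rfl⟩ := Hyperreal.ofSeq_surjective t
  induction f using Germ.inductionOn with
  | h f => rfl

theorem monomial_zero_mul (f : NSExt (ℝ → ℝ)) : monomial 0 * f = f := by
  have h : monomial 0 = 1 := congrArg Germ.const (funext fun x : ℝ => pow_zero x)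
  rw [h, one_mul]

theorem isDivisor_id (N : NSExt ℕ) : IsDivisor N (Germ.const fun x : ℝ => x) fun x => x := by
  refine ⟨fun t _ x _ htx => ?_, analyticOn_id, rfl⟩
  rwa [eval_const_id]

theorem exists_estimator_notMem_halo (N : NSExt ℕ) (θ : ℝ) {t : Hyperreal} (ht : t ∈ grid N)
    (hpos : 0 < t) (hinf : Infinitesimal t) :
    ∃ (n δ est : NSExt (ℝ → ℝ)) (d : ℝ → ℝ) (terms : List EstimTerm),
      IsZeroMeanNoise N n ∧ IsDivisor N δ d ∧ (∀ p ∈ terms, p.Admissible) ∧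
      (∀ s ∈ grid N, EstimatorEq N θ n δ est terms s) ∧
      (∀ z ∈ Set.Icc (0 : ℝ) 1, d z = 0 → z = 0) ∧
      (∀ s ∈ grid N, 0 < s → eval δ s ≠ 0) ∧
      eval est t ∉ halo (θ : Hyperreal) := by
  -- The single term has `c = 1`, `ν = 0`, `k = 1`, so the relation reads `s ([θ]_e(s) - θ) = ∫_0^s
  -- n`.
  refine ⟨pulse t, Germ.const fun x => x, addDivId θ (primitive N (pulse t)), fun x => x,
    [⟨1, 0, 1⟩], isZeroMeanNoise_pulse ht hinf, isDivisor_id N, ?_, ?_, fun z _ hz => hz, ?_, ?_⟩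
  · intro p hp
    rw [List.mem_singleton.1 hp]
    exact ⟨⟨1, by rw [abs_one, Hyperreal.coe_one]⟩, le_rfl⟩
  · intro s _
    simp only [EstimatorEq, EstimTerm.value, List.map_cons, List.map_nil, List.sum_cons,
      List.sum_nil, add_zero, one_mul, Function.iterate_one]
    rw [eval_const_id, eval_addDivId, add_sub_cancel_left, monomial_zero_mul]
    -- At `s = 0` the junk value of the quotient is harmless: `δ` vanishes and the integral is over
    -- an empty set.
    rcases eq_or_ne s 0 with rfl | hs
    · rw [zero_mul, eval_primitive_zero]
    · rw [mul_div_cancel₀ _ hs]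
  · intro s _ hs
    rw [eval_const_id]
    exact hs.ne'
  · intro h
    -- The error at `t` is exactly `t / t = 1`, so the test radius `1` already fails.
    have h₁ := h 1 one_pos
    rw [eval_addDivId, eval_primitive_pulse_self ht, div_self hpos.ne', add_sub_cancel_left,
      abs_one, Hyperreal.coe_one] at h₁
    exact lt_irrefl _ h₁

end NonstandardNoise

end

open NonstandardNoise in
theorem proposition3 (N : NSExt ℕ) (hN : Unlimited N) (θ : ℝ) :
    (∀ (n δ est : NSExt (ℝ → ℝ)) (d : ℝ → ℝ) (terms : List EstimTerm),
      IsZeroMeanNoise N n → IsDivisor N δ d → (∀ p ∈ terms, p.Admissible) →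
      ∀ t ∈ grid N, EstimatorEq N θ n δ est terms t →
        (∀ z ∈ Set.Icc (0 : ℝ) 1, d z = 0 → t ∉ halo (z : Hyperreal)) →
        eval est t ∈ halo (θ : Hyperreal) ∧ Appreciable t) ∧
    (∀ t ∈ grid N, 0 < t → Infinitesimal t →
      ∃ (n δ est : NSExt (ℝ → ℝ)) (d : ℝ → ℝ) (terms : List EstimTerm),
        IsZeroMeanNoise N n ∧ IsDivisor N δ d ∧ (∀ p ∈ terms, p.Admissible) ∧
        (∀ s ∈ grid N, EstimatorEq N θ n δ est terms s) ∧
        (∀ z ∈ Set.Icc (0 : ℝ) 1, d z = 0 → z = 0) ∧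
        (∀ s ∈ grid N, 0 < s → eval δ s ≠ 0) ∧
        eval est t ∉ halo (θ : Hyperreal)) := by
  refine ⟨fun n δ est d terms hn hδ hterms t ht heq hzero =>
    ⟨estimator_mem_halo hN hn hδ hterms ht heq hzero, limited_of_mem_grid ht, fun hinf => ?_⟩,
    fun t ht hpos hinf => exists_estimator_notMem_halo N θ ht hpos hinf⟩
  -- An infinitesimal `t` would lie in the halo of the zero `0` of the divisor.
  refine hzero 0 ⟨le_rfl, zero_le_one⟩ hδ.2.2 ?_
  change Infinitesimal (t - ((0 : ℝ) : Hyperreal))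
  rwa [Hyperreal.coe_zero, sub_zero]
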